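/- For a topological space $X$, let $\mathcal{K}(X)$ be the set of nonempty compact nowhere dense subsets of $X$ with the Pixley-Roy topology, in which a base of neighbourhoods of $K\in\mathcal{K}(X)$ is given by the sets $[K,U]=\{H\in\mathcal{K}(X): K\subseteq H\subseteq U\}$, where $U\supseteq K$ is open in $X$. Let $\mathbb{P}$ be the space of irrational numbers with its usual topology. A Luzin space is an uncountable space without isolated points in which every closed nowhere dense set is countable. For a space $X$, let $\mathcal{O}_X$, $\Delta_X$ and $\mathcal{D}_X$ be, respectively, the collection of covers of $X$ by open sets, the collection of covers of $X$ by open dense sets, and the collection of families of subsets of $X$ whose union is dense in $X$. For collections $\mathcal{A},\mathcal{B}$ of families of subsets of $X$, $\mathsf{S}_1(\mathcal{A},\mathcal{B})$ means that for each sequence $\langle\mathcal{U}_n:n\in\omega\rangle$ of members of $\mathcal{A}$ there are $U_n\in\mathcal{U}_n$ with $\{U_n:n\in\omega\}\in\mathcal{B}$, and $\mathsf{U}_{fin}(\mathcal{A},\mathcal{B})$ means that for each such sequence there are finite $\mathcal{F}_n\subseteq\mathcal{U}_n$ with $\{\bigcup\mathcal{F}_n:n\in\omega\}\in\mathcal{B}$.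 **Theorem.** Assume the continuum hypothesis. Then there is a dense subspace $L$ of $\mathcal{K}(\mathbb{P})$ that is a Luzin space and such that $L$ is $T_1$, hereditarily Lindelöf, first countable, $0$-dimensional (the clopen sets form a base), has no isolated points and has a $G_\delta$ diagonal (the diagonal is a $G_\delta$ subset of $L\times L$), and $L$ satisfies $\mathsf{S}_1(\Delta_L,\mathcal{O}_L)$ but not $\mathsf{U}_{fin}(\mathcal{O}_L,\mathcal{D}_L)$. -/

import Mathlib

open Set Topology TopologicalSpace

/-- The family of all open covers of `X`. -/
def OpenCovers (X : Type*) [TopologicalSpace X] : Set (Set (Set X)) :=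
  {𝒰 | (∀ U ∈ 𝒰, IsOpen U) ∧ ⋃₀ 𝒰 = univ}

/-- The family of all covers of `X` by open dense sets. -/
def DenseOpenCovers (X : Type*) [TopologicalSpace X] : Set (Set (Set X)) :=
  {𝒰 | (∀ U ∈ 𝒰, IsOpen U ∧ Dense U) ∧ ⋃₀ 𝒰 = univ}

/-- The family of all weak covers of `X`: collections of subsets whose union is dense. -/
def WeakCovers (X : Type*) [TopologicalSpace X] : Set (Set (Set X)) :=
  {𝒰 | Dense (⋃₀ 𝒰)}

/-- The selection principle `S₁(𝒜, ℬ)`. -/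
def SelOne {X : Type*} (𝒜 ℬ : Set (Set (Set X))) : Prop :=
  ∀ 𝒰 : ℕ → Set (Set X), (∀ n, 𝒰 n ∈ 𝒜) →
    ∃ U : ℕ → Set X, (∀ n, U n ∈ 𝒰 n) ∧ range U ∈ ℬ

/-- The selection principle `U_fin(𝒜, ℬ)`. -/
def SelUfin {X : Type*} (𝒜 ℬ : Set (Set (Set X))) : Prop :=
  ∀ 𝒰 : ℕ → Set (Set X), (∀ n, 𝒰 n ∈ 𝒜) →
    ∃ ℱ : ℕ → Set (Set X), (∀ n, (ℱ n).Finite ∧ ℱ n ⊆ 𝒰 n) ∧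
      range (fun n => ⋃₀ ℱ n) ∈ ℬ

/-- `X` has no isolated points. -/
def NoIsolatedPoints (X : Type*) [TopologicalSpace X] : Prop :=
  ∀ x : X, ¬ IsOpen ({x} : Set X)

/-- `X` is 0-dimensional: its clopen sets form a base. -/
def ZeroDimensional (X : Type*) [TopologicalSpace X] : Prop :=
  IsTopologicalBasis {s : Set X | IsClopen s}

/-- `X` has a `G_δ` diagonal. -/
def HasGdeltaDiagonal (X : Type*) [TopologicalSpace X] : Prop :=
  IsGδ (diagonal X)

/-- `X` is a Luzin space. -/
def IsLuzinSpace (X : Type*) [TopologicalSpace X] : Prop :=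
  Uncountable X ∧ NoIsolatedPoints X ∧
    ∀ s : Set X, IsClosed s → IsNowhereDense s → s.Countable

/-- The points of the Pixley-Roy space `𝒦(X)`: the nonempty compact nowhere dense subsets of `X`.
(The empty set, were it admitted, would be an isolated point, since `[∅, ∅] = {∅}`.) -/
structure PixleyRoy (X : Type*) [TopologicalSpace X] where
  carrier : Set X
  nonempty : carrier.Nonempty
  isCompact : IsCompact carrier
  isNowhereDense : IsNowhereDense carrier

/-- The set `[F, G] = {H ∈ 𝒦(X) : F ⊆ H ⊆ G}`. -/
def PixleyRoy.between {X : Type*} [TopologicalSpace X] (F G : Set X) : Set (PixleyRoy X) :=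
  {H | F ⊆ H.carrier ∧ H.carrier ⊆ G}

/-- The Pixley-Roy topology: the sets `[K, U]` with `U` open and `K ⊆ U` form a base of
neighbourhoods of `K`. -/
instance PixleyRoy.instTopologicalSpace (X : Type*) [TopologicalSpace X] :
    TopologicalSpace (PixleyRoy X) where
  IsOpen 𝒱 := ∀ K ∈ 𝒱, ∃ U : Set X, IsOpen U ∧ K.carrier ⊆ U ∧
    PixleyRoy.between K.carrier U ⊆ 𝒱
  isOpen_univ := fun _ _ => ⟨univ, isOpen_univ, subset_univ _, subset_univ _⟩
  isOpen_inter := by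
    rintro 𝒱 𝒲 h𝒱 h𝒲 K ⟨hK, hK'⟩
    obtain ⟨U, hU, hKU, hU𝒱⟩ := h𝒱 K hK
    obtain ⟨V, hV, hKV, hV𝒲⟩ := h𝒲 K hK'
    exact ⟨U ∩ V, hU.inter hV, subset_inter hKU hKV, fun H hH =>
      ⟨hU𝒱 ⟨hH.1, hH.2.trans inter_subset_left⟩, hV𝒲 ⟨hH.1, hH.2.trans inter_subset_right⟩⟩⟩
  isOpen_sUnion := by
    rintro S hS K ⟨𝒱, h𝒱, hK⟩
    obtain ⟨U, hU, hKU, hU𝒱⟩ := hS 𝒱 h𝒱 K hK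
    exact ⟨U, hU, hKU, fun H hH => ⟨𝒱, h𝒱, hU𝒱 hH⟩⟩

/-- The space of irrational numbers, with the topology inherited from `ℝ`. -/
abbrev Irrationals : Type := {x : ℝ // Irrational x}

/-! Compact sets of irrationals are nowhere dense, so `PixleyRoy Irrationals` consists of all
nonempty compact sets and is closed under finite unions. This yields the countable chain condition;
complete metrizability of the irrationals yields the Baire property (`PixleyRoy.baireSpace`).

By ccc, each nowhere dense set misses a dense open set that is a countable union of base members.
Under CH these unions can be listed in type ω₁, and Baire category gives points lying in all dense
ones listed earlier. Their range `L` is a Luzin set (`exists_denseRange_countable_preimage`). Being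
Luzin gives `SelOne`, and together with ccc it gives hereditary Lindelöfness.

`SelUfin` fails because the irrationals behave like a Baire space of sequences: partial quotients of
continued fractions are continuous and can exceed any prescribed sequence. Compact sets containing
such a point escape all the finite selections (`PixleyRoy.not_selUfin`). -/

/-- In a space with the countable chain condition, each family of open sets has a countable
subfamily whose union is dense in the union of the whole family. -/
theorem exists_countable_dense_subfamily {X : Type*} [TopologicalSpace X]
    (hX : ∀ 𝒜 : Set (Set X), (∀ U ∈ 𝒜, IsOpen U ∧ U.Nonempty) → 𝒜.PairwiseDisjoint id →
      𝒜.Countable)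
    (𝒲 : Set (Set X)) (h𝒲 : ∀ U ∈ 𝒲, IsOpen U) :
    ∃ 𝒱 ⊆ 𝒲, 𝒱.Countable ∧ ⋃₀ 𝒲 ⊆ closure (⋃₀ 𝒱) := by
  -- Take a maximal disjoint family of nonempty open sets refining `𝒲`, and enlarge each to a member
  -- of `𝒲`. An open piece of `⋃₀ 𝒲` missed by these could be added to the family.
  obtain ⟨𝒜, h𝒜⟩ := zorn_subset
    {𝒜 : Set (Set X) | (∀ U ∈ 𝒜, (IsOpen U ∧ U.Nonempty) ∧ ∃ W ∈ 𝒲, U ⊆ W) ∧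
      𝒜.PairwiseDisjoint id} (by
    intro c hc hchain
    refine ⟨⋃₀ c, ⟨?_, ?_⟩, fun s hs => subset_sUnion_of_mem hs⟩
    · rintro U ⟨s, hs, hU⟩
      exact (hc hs).1 U hU
    · rw [pairwiseDisjoint_sUnion hchain.directedOn]
      exact fun s hs => (hc hs).2)
  have hW : ∀ U ∈ 𝒜, ∃ W ∈ 𝒲, U ⊆ W := fun U hU => (h𝒜.prop.1 U hU).2
  choose! W hW𝒲 hUW using hW
  refine ⟨W '' 𝒜, image_subset_iff.2 hW𝒲,
    (hX 𝒜 (fun U hU => (h𝒜.prop.1 U hU).1) h𝒜.prop.2).image W, ?_⟩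
  rintro p ⟨V, hV, hpV⟩
  rw [mem_closure_iff]
  intro O hO hpO
  by_contra hne
  have hdisj : ∀ U ∈ 𝒜, Disjoint (O ∩ V) U := by
    intro U hU
    rw [Set.disjoint_left]
    exact fun y hy hyU => hne ⟨y, hy.1, W U, mem_image_of_mem W hU, hUW U hU hyU⟩
  have hins : insert (O ∩ V) 𝒜 ∈ {𝒜 : Set (Set X) |
      (∀ U ∈ 𝒜, (IsOpen U ∧ U.Nonempty) ∧ ∃ W ∈ 𝒲, U ⊆ W) ∧ 𝒜.PairwiseDisjoint id} := by
    refine ⟨?_, h𝒜.prop.2.insert fun U hU _ => hdisj U hU⟩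
    rintro U (rfl | hU)
    · exact ⟨⟨hO.inter (h𝒲 V hV), p, hpO, hpV⟩, V, hV, inter_subset_right⟩
    · exact h𝒜.prop.1 U hU
  have hmem : O ∩ V ∈ 𝒜 := h𝒜.le_of_ge hins (subset_insert _ _) (mem_insert _ _)
  exact Set.disjoint_left.1 (hdisj _ hmem) ⟨hpO, hpV⟩ ⟨hpO, hpV⟩

/-- A second countable space has a countable family of open sets containing a neighbourhood base
of every compact set. -/
theorem exists_countable_open_family_compact (X : Type*) [TopologicalSpace X]
    [SecondCountableTopology X] :
    ∃ W : ℕ → Set X, (∀ n, IsOpen (W n)) ∧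
      ∀ K U : Set X, IsCompact K → IsOpen U → K ⊆ U → ∃ n, K ⊆ W n ∧ W n ⊆ U := by
  -- The family wanted is that of finite unions of basic open sets.
  have hc : {s : Set (Set X) | s.Finite ∧ s ⊆ countableBasis X}.Countable :=
    countable_ofPred_finite_subset (countable_countableBasis X)
  obtain ⟨S, hS⟩ := hc.exists_eq_range ⟨∅, finite_empty, empty_subset _⟩
  have hS' : ∀ n, (S n).Finite ∧ S n ⊆ countableBasis X := fun n => by
    have : S n ∈ range S := mem_range_self n
    rwa [← hS] at this
  refine ⟨fun n => ⋃₀ S n, fun n => isOpen_sUnion fun s hs =>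
    isOpen_of_mem_countableBasis ((hS' n).2 hs), ?_⟩
  intro K U hK hU hKU
  obtain ⟨t, htS, htf, ht⟩ := hK.elim_finite_subcover_image
    (b := {s ∈ countableBasis X | s ⊆ U}) (c := id)
    (fun s hs => isOpen_of_mem_countableBasis hs.1) (by
      intro x hx
      obtain ⟨s, hs, hxs, hsU⟩ := (isBasis_countableBasis X).exists_subset_of_mem_open
        (hKU hx) hU
      exact mem_biUnion (show s ∈ {s ∈ countableBasis X | s ⊆ U} from ⟨hs, hsU⟩) hxs)
  have : t ∈ range S := hS ▸ ⟨htf, fun s hs => (htS hs).1⟩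
  obtain ⟨n, rfl⟩ := this
  refine ⟨n, ?_, sUnion_subset fun s hs => (htS hs).2⟩
  simpa [sUnion_eq_biUnion] using ht

/-! ### The Pixley-Roy topology -/

namespace PixleyRoy

section Basic
variable {X : Type*} [TopologicalSpace X]

theorem carrier_injective : Function.Injective (carrier : PixleyRoy X → Set X) := by
  rintro ⟨_, _, _, _⟩ ⟨_, _, _, _⟩ h
  cases h
  rfl

theorem isOpen_between (F : Set X) {U : Set X} (hU : IsOpen U) : IsOpen (between F U) :=
  fun _ hH => ⟨U, hU, hH.2, fun _ hJ => ⟨hH.1.trans hJ.1, hJ.2⟩⟩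

theorem exists_between_subset {𝒱 : Set (PixleyRoy X)} (h𝒱 : IsOpen 𝒱) {K : PixleyRoy X}
    (hK : K ∈ 𝒱) : ∃ U, IsOpen U ∧ K.carrier ⊆ U ∧ between K.carrier U ⊆ 𝒱 :=
  h𝒱 K hK

theorem hasBasis_nhds (K : PixleyRoy X) :
    (𝓝 K).HasBasis (fun U => IsOpen U ∧ K.carrier ⊆ U) (between K.carrier) := by
  refine ⟨fun 𝒱 => ?_⟩
  rw [mem_nhds_iff]
  constructor
  · rintro ⟨𝒰, h𝒰, ho, hK⟩
    obtain ⟨U, hU, hKU, hs⟩ := exists_between_subset ho hK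
    exact ⟨U, ⟨hU, hKU⟩, hs.trans h𝒰⟩
  · rintro ⟨U, ⟨hU, hKU⟩, hs⟩
    exact ⟨_, hs, isOpen_between _ hU, Subset.rfl, hKU⟩

theorem isClosed_between [T1Space X] (F G : Set X) : IsClosed (between F G) := by
  refine ⟨fun H hH => ?_⟩
  by_cases hF : F ⊆ H.carrier
  · exact ⟨univ, isOpen_univ, subset_univ _, fun J hJ hJ' =>
      hH ⟨hF, hJ.1.trans hJ'.2⟩⟩
  · obtain ⟨x, hxF, hxH⟩ := not_subset.1 hF
    exact ⟨{x}ᶜ, isOpen_compl_singleton, fun y hy h => hxH (h ▸ hy),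
      fun J hJ hJ' => hJ.2 (hJ'.1 hxF) rfl⟩

theorem between_self (K : PixleyRoy X) : between K.carrier K.carrier = {K} := by
  ext H
  exact ⟨fun h => carrier_injective (h.2.antisymm h.1), fun h => h ▸ ⟨Subset.rfl, Subset.rfl⟩⟩

instance [T1Space X] : T1Space (PixleyRoy X) :=
  ⟨fun K => between_self K ▸ isClosed_between _ _⟩

theorem zeroDimensional [T1Space X] : ZeroDimensional (PixleyRoy X) := by
  refine isTopologicalBasis_of_isOpen_of_nhds (fun U hU => hU.isOpen) fun K 𝒱 hK h𝒱 => ?_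
  obtain ⟨U, hU, hKU, hs⟩ := exists_between_subset h𝒱 hK
  exact ⟨_, ⟨isClosed_between _ _, isOpen_between _ hU⟩, ⟨Subset.rfl, hKU⟩, hs⟩

instance [SecondCountableTopology X] : FirstCountableTopology (PixleyRoy X) := by
  obtain ⟨W, hWo, hW⟩ := exists_countable_open_family_compact X
  refine ⟨fun K => ?_⟩
  have : (𝓝 K).HasBasis (fun n => K.carrier ⊆ W n) (fun n => between K.carrier (W n)) :=
    (hasBasis_nhds K).to_hasBasis
      (fun U hU => by
        obtain ⟨n, hn, hnU⟩ := hW K.carrier U K.isCompact hU.1 hU.2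
        exact ⟨n, hn, fun H hH => ⟨hH.1, hH.2.trans hnU⟩⟩)
      (fun n hn => ⟨W n, ⟨hWo n, hn⟩, Subset.rfl⟩)
  exact Filter.HasCountableBasis.isCountablyGenerated ⟨this, to_countable _⟩

end Basic

/-- If `(H, J)` lies in every `G n`, some `K ⊆ J` has `H` in its `1 / (n + 1)`-thickening, so `H`
lies in the closure of `J`, which is `J`. The situation is symmetric. -/
theorem hasGdeltaDiagonal {X : Type*} [MetricSpace X] : HasGdeltaDiagonal (PixleyRoy X) := by
  set G : ℕ → Set (PixleyRoy X × PixleyRoy X) := fun n => ⋃ K : PixleyRoy X,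
    between K.carrier (Metric.thickening (1 / (n + 1 : ℝ)) K.carrier) ×ˢ
      between K.carrier (Metric.thickening (1 / (n + 1 : ℝ)) K.carrier) with hG
  have hGo : ∀ n, IsOpen (G n) := fun n => isOpen_iUnion fun K =>
    (isOpen_between _ Metric.isOpen_thickening).prod (isOpen_between _ Metric.isOpen_thickening)
  have key : ∀ p : PixleyRoy X × PixleyRoy X, (∀ n, p ∈ G n) → p.1.carrier ⊆ p.2.carrier := by
    intro p hp x hx
    rw [← p.2.isCompact.isClosed.closure_eq, Metric.mem_closure_iff]
    intro ε hε
    obtain ⟨n, hn⟩ := exists_nat_one_div_lt hε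
    obtain ⟨K, h1, h2⟩ := mem_iUnion.1 (hp n)
    obtain ⟨y, hy, hxy⟩ := Metric.mem_thickening_iff.1 (h1.2 hx)
    exact ⟨y, h2.1 hy, hxy.trans hn⟩
  have hdiag : diagonal (PixleyRoy X) = ⋂ n, G n := by
    refine Subset.antisymm ?_ ?_
    · rintro ⟨K, K'⟩ h
      obtain rfl : K = K' := h
      refine mem_iInter.2 fun n => mem_iUnion.2 ⟨K, ?_⟩
      have : K.carrier ⊆ Metric.thickening (1 / (n + 1 : ℝ)) K.carrier :=
        Metric.self_subset_thickening (by positivity) _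
      exact ⟨⟨Subset.rfl, this⟩, Subset.rfl, this⟩
    · intro p hp
      have hp' := mem_iInter.1 hp
      refine carrier_injective ((key p hp').antisymm (key p.swap fun n => ?_))
      obtain ⟨K, h1, h2⟩ := mem_iUnion.1 (hp' n)
      exact mem_iUnion.2 ⟨K, h2, h1⟩
  rw [HasGdeltaDiagonal, hdiag]
  exact .iInter_of_isOpen hGo

section CompactNowhereDense
variable {X : Type*} [TopologicalSpace X]

/-- The point of the Pixley-Roy space given by a compact set, when all of these are nowhere
dense. -/
def ofCompact (hX : ∀ K : Set X, IsCompact K → IsNowhereDense K) (K : Set X)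
    (hne : K.Nonempty) (hK : IsCompact K) : PixleyRoy X :=
  ⟨K, hne, hK, hX K hK⟩

theorem noIsolatedPoints (hX : ∀ K : Set X, IsCompact K → IsNowhereDense K) :
    NoIsolatedPoints (PixleyRoy X) := by
  intro K hK
  obtain ⟨U, hU, hKU, hs⟩ := exists_between_subset hK rfl
  have hne : ¬ U ⊆ K.carrier := fun h => by
    have h1 : U ⊆ interior (closure K.carrier) :=
      hU.subset_interior_iff.2 (h.trans subset_closure)
    rw [K.isNowhereDense] at h1
    obtain ⟨x, hx⟩ := K.nonempty
    exact h1 (hKU hx)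
  obtain ⟨x, hxU, hxK⟩ := not_subset.1 hne
  have : ofCompact hX (insert x K.carrier) (insert_nonempty _ _) (K.isCompact.insert x)
      ∈ ({K} : Set (PixleyRoy X)) :=
    hs ⟨subset_insert _ _, insert_subset hxU hKU⟩
  have h2 : insert x K.carrier = K.carrier := congrArg carrier this
  exact hxK (h2 ▸ mem_insert x _)

/-- Neighbourhoods of `K` and `H` with the same outer set `W n` share the point `K ∪ H`, so disjoint
open sets receive distinct indices. -/
theorem countable_of_pairwiseDisjoint [SecondCountableTopology X]
    (hX : ∀ K : Set X, IsCompact K → IsNowhereDense K)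
    (𝒜 : Set (Set (PixleyRoy X))) (h𝒜 : ∀ 𝒰 ∈ 𝒜, IsOpen 𝒰 ∧ 𝒰.Nonempty)
    (hd : 𝒜.PairwiseDisjoint id) : 𝒜.Countable := by
  obtain ⟨W, hWo, hW⟩ := exists_countable_open_family_compact X
  have : ∀ 𝒰 ∈ 𝒜, ∃ (n : ℕ) (K : PixleyRoy X), K.carrier ⊆ W n ∧
      between K.carrier (W n) ⊆ 𝒰 := by
    intro 𝒰 h𝒰
    obtain ⟨ho, K, hK⟩ := h𝒜 𝒰 h𝒰
    obtain ⟨U, hU, hKU, hs⟩ := exists_between_subset ho hK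
    obtain ⟨n, hn, hnU⟩ := hW K.carrier U K.isCompact hU hKU
    exact ⟨n, K, hn, fun H hH => hs ⟨hH.1, hH.2.trans hnU⟩⟩
  choose! n hn using this
  refine MapsTo.countable_of_injOn (f := n) (t := univ) (fun _ _ => mem_univ _) ?_ (to_countable _)
  intro 𝒰 h𝒰 𝒱 h𝒱 hnn
  have hnn : n 𝒰 = n 𝒱 := hnn
  obtain ⟨K, hK, hK𝒰⟩ := hn 𝒰 h𝒰
  obtain ⟨H, hH, hH𝒱⟩ := hn 𝒱 h𝒱
  rw [← hnn] at hH hH𝒱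
  exact hd.elim_set h𝒰 h𝒱 (ofCompact hX (K.carrier ∪ H.carrier) K.nonempty.inl
    (K.isCompact.union H.isCompact)) (hK𝒰 ⟨subset_union_left, union_subset hK hH⟩)
    (hH𝒱 ⟨subset_union_right, union_subset hK hH⟩)

open Metric in
-- Along a sequence of shrinking neighbourhoods `[K, U]` the inner sets grow and the outer sets
-- shrink. Making the outer sets totally bounded at ever finer scales leaves a compact intersection,
-- which belongs to all the neighbourhoods.
theorem baireSpace [IsCompletelyMetrizableSpace X]
    (hX : ∀ K : Set X, IsCompact K → IsNowhereDense K) : BaireSpace (PixleyRoy X) := by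
  let := upgradeIsCompletelyMetrizable X
  refine ⟨fun f hfo hfd => ?_⟩
  have step : ∀ (n : ℕ) (p : {p : PixleyRoy X × Set X // IsOpen p.2 ∧ p.1.carrier ⊆ p.2}),
      ∃ q : {p : PixleyRoy X × Set X // IsOpen p.2 ∧ p.1.carrier ⊆ p.2},
        p.1.1.carrier ⊆ q.1.1.carrier ∧ closure q.1.2 ⊆ p.1.2 ∧
        between q.1.1.carrier q.1.2 ⊆ f n ∧
        ∃ t : Set X, t.Finite ∧ closure q.1.2 ⊆ ⋃ y ∈ t, ball y (1 / (n + 1 : ℝ)) := by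
    rintro n ⟨⟨K, U⟩, hU, hKU⟩
    obtain ⟨K', hK', hK'f⟩ := (hfd n).inter_open_nonempty _ (isOpen_between K.carrier hU)
      ⟨K, Subset.rfl, hKU⟩
    obtain ⟨V, hV, hKV, hs⟩ := exists_between_subset (hfo n) hK'f
    obtain ⟨t, -, htf, ht⟩ := K'.isCompact.finite_cover_balls
      (e := 1 / (n + 1 : ℝ)) (by positivity)
    obtain ⟨δ, hδ, hδs⟩ := K'.isCompact.exists_cthickening_subset_open
      (t := U ∩ V ∩ ⋃ y ∈ t, ball y (1 / (n + 1 : ℝ)))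
      ((hU.inter hV).inter (isOpen_biUnion fun _ _ => isOpen_ball))
      (subset_inter (subset_inter hK'.2 hKV) ht)
    have hcl : closure (thickening δ K'.carrier) ⊆ _ :=
      (closure_thickening_subset_cthickening δ K'.carrier).trans hδs
    refine ⟨⟨⟨K', thickening δ K'.carrier⟩, isOpen_thickening, self_subset_thickening hδ _⟩,
      hK'.1, fun x hx => (hcl hx).1.1, fun H hH => hs ⟨hH.1, fun x hx =>
        (hcl (subset_closure (hH.2 hx))).1.2⟩, t, htf, fun x hx => (hcl hx).2⟩
  choose next hK hU hf ht using step
  rw [dense_iff_inter_open]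
  rintro 𝒪 h𝒪 ⟨K₀, hK₀⟩
  obtain ⟨U₀, hU₀, hKU₀, hs₀⟩ := exists_between_subset h𝒪 hK₀
  let p : ℕ → {p : PixleyRoy X × Set X // IsOpen p.2 ∧ p.1.carrier ⊆ p.2} := fun n =>
    Nat.rec ⟨⟨K₀, U₀⟩, hU₀, hKU₀⟩ next n
  have hKmono : Monotone fun n => (p n).1.1.carrier := monotone_nat_of_le_succ fun n => hK n (p n)
  have hUanti : Antitone fun n => (p n).1.2 :=
    antitone_nat_of_succ_le fun n => subset_closure.trans (hU n (p n))
  have hKU : ∀ m n, (p m).1.1.carrier ⊆ (p n).1.2 := fun m n =>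
    (hKmono (le_max_left m n)).trans ((p (max m n)).2.2.trans (hUanti (le_max_right m n)))
  -- The index starts at `n + 1` because the initial `U₀` need not have any finite cover by small
  -- balls.
  set C : Set X := ⋂ n, closure (p (n + 1)).1.2 with hC
  have hKC : ∀ m, (p m).1.1.carrier ⊆ C := fun m =>
    subset_iInter fun n => (hKU m (n + 1)).trans subset_closure
  have hCU : ∀ n, C ⊆ (p n).1.2 := fun n => (iInter_subset _ n).trans (hU n (p n))
  have hCc : IsCompact C := by
    refine TotallyBounded.isCompact_of_isClosed ?_ (isClosed_iInter fun n => isClosed_closure)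
    refine totallyBounded_iff.2 fun ε hε => ?_
    obtain ⟨n, hn⟩ := exists_nat_one_div_lt hε
    obtain ⟨t, htf, hts⟩ := ht n (p n)
    exact ⟨t, htf, (iInter_subset _ n).trans (hts.trans
      (iUnion₂_mono fun y _ => ball_subset_ball hn.le))⟩
  refine ⟨ofCompact hX C (K₀.nonempty.mono (hKC 0)) hCc, hs₀ ⟨hKC 0, hCU 0⟩, mem_iInter.2 fun n => ?_⟩
  exact hf n (p n) ⟨hKC (n + 1), hCU (n + 1)⟩

end CompactNowhereDense

/-- The Pixley-Roy space of a second countable Hausdorff space has a base of nonempty sets indexed by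
a type of cardinality at most the continuum. -/
theorem exists_base_card_le_continuum (X : Type) [TopologicalSpace X] [SecondCountableTopology X] [T2Space X] :
    ∃ (ι : Type) (B : ι → Set (PixleyRoy X)), Cardinal.mk ι ≤ Cardinal.continuum ∧
      (∀ i, IsOpen (B i) ∧ (B i).Nonempty) ∧
      ∀ 𝒰 : Set (PixleyRoy X), IsOpen 𝒰 → ∀ K ∈ 𝒰, ∃ i, K ∈ B i ∧ B i ⊆ 𝒰 := by
  obtain ⟨W, hWo, hW⟩ := exists_countable_open_family_compact X
  refine ⟨{p : PixleyRoy X × ℕ // p.1.carrier ⊆ W p.2}, fun p => between p.1.1.carrier (W p.1.2),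
    ?_, fun p => ⟨isOpen_between _ (hWo _), p.1.1, Subset.rfl, p.2⟩, ?_⟩
  · refine (Cardinal.mk_subtype_le _).trans ?_
    -- A compact set is determined by the `W n` that contain it.
    have hinj : Function.Injective fun (K : PixleyRoy X) => {n | K.carrier ⊆ W n} := by
      have key : ∀ K H : PixleyRoy X, {n | K.carrier ⊆ W n} = {n | H.carrier ⊆ W n} →
          K.carrier ⊆ H.carrier := by
        intro K H h x hxK
        by_contra hxH
        obtain ⟨n, hn, hnx⟩ := hW H.carrier {x}ᶜ H.isCompact isOpen_compl_singleton
          (fun y hy h => hxH (h ▸ hy))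
        have hn' : n ∈ {n | K.carrier ⊆ W n} := h ▸ hn
        exact hnx (hn' hxK) rfl
      exact fun K H h => carrier_injective ((key K H h).antisymm (key H K h.symm))
    have hle : Cardinal.mk (PixleyRoy X) ≤ Cardinal.continuum := by
      simpa using Cardinal.mk_le_of_injective hinj
    rw [Cardinal.mk_prod, Cardinal.lift_id, Cardinal.lift_id, Cardinal.mk_nat]
    exact (mul_le_mul' hle le_rfl).trans_eq Cardinal.continuum_mul_aleph0
  · intro 𝒰 h𝒰 K hK
    obtain ⟨U, hU, hKU, hs⟩ := exists_between_subset h𝒰 hK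
    obtain ⟨n, hn, hnU⟩ := hW K.carrier U K.isCompact hU hKU
    exact ⟨⟨(K, n), hn⟩, ⟨Subset.rfl, hn⟩, fun H hH => hs ⟨hH.1, hH.2.trans hnU⟩⟩

end PixleyRoy

/-! ### Construction of the Luzin set -/

/-- Under the continuum hypothesis, a Baire space with a countable chain condition and a base of
cardinality at most the continuum has a dense family of points, indexed by the reals, which meets
every nowhere dense set at countably many indices. -/
theorem exists_denseRange_countable_preimage
    (hCH : Cardinal.continuum.{0} = Cardinal.aleph.{0} 1) {X ι : Type} [TopologicalSpace X]
    [BaireSpace X] [Nonempty ι] (B : ι → Set X) (hι : Cardinal.mk ι ≤ Cardinal.continuum)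
    (hB : ∀ i, IsOpen (B i) ∧ (B i).Nonempty)
    (hbase : ∀ U : Set X, IsOpen U → ∀ x ∈ U, ∃ i, x ∈ B i ∧ B i ⊆ U)
    (hccc : ∀ 𝒲 : Set (Set X), (∀ U ∈ 𝒲, IsOpen U) →
      ∃ 𝒱 ⊆ 𝒲, 𝒱.Countable ∧ ⋃₀ 𝒲 ⊆ closure (⋃₀ 𝒱)) :
    ∃ x : ℝ → X, DenseRange x ∧ ∀ N : Set X, IsNowhereDense N → (x ⁻¹' N).Countable := by
  -- This well-order of `ℝ` has the least possible type, ω₁ under CH, so its initial segments are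
  -- countable.
  obtain ⟨r, hwo, hr⟩ := Cardinal.exists_ord_eq ℝ
  have hseg : ∀ t, {s | r s t}.Countable := by
    intro t
    have h1 := Cardinal.card_typein_lt t hr
    rw [Ordinal.card_typein, Cardinal.mk_real, hCH, ← Cardinal.succ_aleph0, Order.lt_succ_iff] at h1
    exact Cardinal.mk_le_aleph0_iff.1 h1
  have hcard : Cardinal.mk (ι × (ℕ → ι)) ≤ Cardinal.mk ℝ := by
    have hpow : Cardinal.mk (ℕ → ι) ≤ Cardinal.continuum := by
      rw [← Cardinal.power_def, Cardinal.mk_nat]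
      exact (Cardinal.power_le_power_right hι).trans_eq Cardinal.continuum_power_aleph0
    rw [Cardinal.mk_prod, Cardinal.lift_id, Cardinal.lift_id, Cardinal.mk_real]
    exact (mul_le_mul' hι hpow).trans_eq Cardinal.continuum_mul_self
  obtain ⟨f⟩ := Cardinal.le_def _ _ |>.1 hcard
  -- The first coordinate names a basic set that the point must enter, for density; the second codes
  -- a countable union of basic sets.
  let e : ℝ → ι × (ℕ → ι) := Function.invFun f
  have he : Function.Surjective e := Function.invFun_surjective f.injective
  let D : ℝ → Set X := fun s => {x | Dense (⋃ n, B ((e s).2 n)) → x ∈ ⋃ n, B ((e s).2 n)}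
  have hD : ∀ s, IsOpen (D s) ∧ Dense (D s) := by
    intro s
    by_cases h : Dense (⋃ n, B ((e s).2 n))
    · have : D s = ⋃ n, B ((e s).2 n) := by ext x; simp only [D, h, true_imp_iff, ofPred_mem_eq]
      rw [this]
      exact ⟨isOpen_iUnion fun n => (hB _).1, h⟩
    · have : D s = univ := by ext x; simp only [D, h, false_imp_iff, ofPred_true]
      rw [this]
      exact ⟨isOpen_univ, dense_univ⟩
  -- Only the earlier dense sets matter, not the earlier points, so no recursion is needed.
  have hx : ∀ t, ∃ x, x ∈ B (e t).1 ∧ ∀ s, r s t → x ∈ D s := by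
    intro t
    obtain ⟨x, hx1, hx2⟩ := (dense_biInter_of_isOpen (fun s (_ : s ∈ {s | r s t}) => (hD s).1)
      (hseg t) (fun s _ => (hD s).2)).inter_open_nonempty _ (hB (e t).1).1 (hB (e t).1).2
    exact ⟨x, hx1, fun s hs => mem_iInter₂.1 hx2 s hs⟩
  choose x hxB hxD using hx
  refine ⟨x, ?_, fun N hN => ?_⟩
  · refine dense_iff_inter_open.2 fun U hU hne => ?_
    obtain ⟨y, hy⟩ := hne
    obtain ⟨i, -, hi⟩ := hbase U hU y hy
    obtain ⟨t, ht⟩ := he (i, fun _ => i)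
    refine ⟨x t, hi ?_, t, rfl⟩
    have := hxB t
    rwa [ht] at this
  · have hdense : Dense (closure N)ᶜ := by
      rw [← interior_eq_empty_iff_dense_compl]
      exact hN
    obtain ⟨𝒱, h𝒱, h𝒱c, hcl⟩ := hccc {U | ∃ i, U = B i ∧ B i ⊆ (closure N)ᶜ} (by
      rintro _ ⟨i, rfl, -⟩
      exact (hB i).1)
    have h𝒱d : Dense (⋃₀ 𝒱) := by
      refine dense_closure.1 (hdense.mono fun y hy => hcl ?_)
      obtain ⟨i, hyi, hi⟩ := hbase _ isClosed_closure.isOpen_compl y hy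
      exact ⟨B i, ⟨i, rfl, hi⟩, hyi⟩
    -- The index `t₀` codes a dense open set missing `N`; every point with a later index lies in
    -- that set.
    obtain ⟨t₀, ht₀⟩ : ∃ t₀, Dense (⋃ n, B ((e t₀).2 n)) ∧
        ⋃ n, B ((e t₀).2 n) ⊆ (closure N)ᶜ := by
      rcases 𝒱.eq_empty_or_nonempty with rfl | hne
      · have i : ι := Classical.arbitrary ι
        obtain ⟨y, hy⟩ := (hB i).2
        simp only [sUnion_empty] at h𝒱d
        exact absurd (h𝒱d y) (by simp)
      · obtain ⟨S, rfl⟩ := h𝒱c.exists_eq_range hne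
        choose s hs hsN using fun n => h𝒱 (mem_range_self n)
        obtain ⟨t₀, ht₀⟩ := he (Classical.arbitrary ι, s)
        have : ⋃ n, B ((e t₀).2 n) = ⋃₀ range S := by
          rw [ht₀, sUnion_range]
          exact iUnion_congr fun n => (hs n).symm
        exact ⟨t₀, this ▸ h𝒱d, ht₀ ▸ iUnion_subset hsN⟩
    refine ((hseg t₀).insert t₀).mono fun t ht => ?_
    rcases trichotomous_of r t t₀ with h | h | h
    · exact Or.inr h
    · exact Or.inl h
    · exact absurd (subset_closure (show x t ∈ N from ht)) (ht₀.2 (hxD t t₀ h ht₀.1))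

/-! ### Luzin subspaces and their covering properties -/

section DenseSubspace
variable {X : Type*} [TopologicalSpace X] {L : Set X}

theorem Dense.noIsolatedPoints [T1Space X] (hL : Dense L) (hX : NoIsolatedPoints X) :
    NoIsolatedPoints L := by
  intro x hx
  obtain ⟨U, hU, hUx⟩ := isOpen_induced_iff.1 hx
  refine hX x ?_
  have : U = {x.1} := by
    by_contra hne
    have hxU : x ∈ Subtype.val ⁻¹' U := hUx ▸ mem_singleton x
    obtain ⟨y, hyU, hyx⟩ : (U \ {x.1}).Nonempty := by
      rw [sdiff_nonempty]
      exact fun h => hne (h.antisymm (singleton_subset_iff.2 hxU))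
    obtain ⟨z, ⟨hzU, hzx⟩, hzL⟩ := hL.inter_open_nonempty _ (hU.sdiff isClosed_singleton)
      ⟨y, hyU, hyx⟩
    have : (⟨z, hzL⟩ : L) ∈ ({x} : Set L) := hUx ▸ hzU
    exact hzx (congrArg Subtype.val this)
  exact this ▸ hU

theorem ZeroDimensional.subtype (hX : ZeroDimensional X) (L : Set X) : ZeroDimensional L := by
  refine isTopologicalBasis_of_isOpen_of_nhds (fun U hU => hU.isOpen) fun x V hxV hV => ?_
  obtain ⟨U, hU, rfl⟩ := isOpen_induced_iff.1 hV
  obtain ⟨W, hW, hxW, hWU⟩ := IsTopologicalBasis.exists_subset_of_mem_open hX hxV hU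
  exact ⟨_, IsClopen.preimage hW continuous_subtype_val, hxW, preimage_mono hWU⟩

theorem HasGdeltaDiagonal.subtype (hX : HasGdeltaDiagonal X) (L : Set X) :
    HasGdeltaDiagonal L := by
  have : diagonal L = Prod.map Subtype.val Subtype.val ⁻¹' diagonal X := by
    ext p
    exact Subtype.ext_iff
  rw [HasGdeltaDiagonal, this]
  exact IsGδ.preimage (continuous_subtype_val.prodMap continuous_subtype_val) hX

/-- A countable subfamily with dense union leaves uncovered only points in the frontier of its
union. The frontier is nowhere dense, so those points are countably many and cost one further set
each. -/
theorem hereditarilyLindelofSpace_of_countable_inter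
    (hccc : ∀ 𝒲 : Set (Set X), (∀ U ∈ 𝒲, IsOpen U) →
      ∃ 𝒱 ⊆ 𝒲, 𝒱.Countable ∧ ⋃₀ 𝒲 ⊆ closure (⋃₀ 𝒱))
    (hL : ∀ N : Set X, IsNowhereDense N → (L ∩ N).Countable) : HereditarilyLindelofSpace L := by
  refine ⟨fun s _ => isLindelof_of_countable_subcover fun {ι} U hU hs => ?_⟩
  choose V hV hVU using fun i => isOpen_induced_iff.1 (hU i)
  obtain ⟨𝒱, h𝒱, h𝒱c, hcl⟩ := hccc (range V) (by
    rintro _ ⟨i, rfl⟩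
    exact hV i)
  have := h𝒱c.to_subtype
  choose g hg using fun W : 𝒱 => h𝒱 W.2
  choose j hj using fun p : s => mem_iUnion.1 (hs p.2)
  have hopen : IsOpen (⋃₀ 𝒱) := isOpen_sUnion fun W hW => by
    obtain ⟨i, rfl⟩ := h𝒱 hW
    exact hV i
  have hfr : {p : s | p.1.1 ∈ frontier (⋃₀ 𝒱)}.Countable := by
    have hnd : IsNowhereDense (frontier (⋃₀ 𝒱)) := by
      rw [isClosed_frontier.isNowhereDense_iff, ← frontier_compl]
      exact interior_frontier hopen.isClosed_compl
    exact ((hL _ hnd).preimage (f := fun p : s => p.1.1)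
        (Subtype.val_injective.comp Subtype.val_injective)).mono fun p hp =>
          mem_preimage.2 (mem_inter p.1.2 hp)
  refine ⟨range g ∪ j '' {p : s | p.1.1 ∈ frontier (⋃₀ 𝒱)},
    (countable_range g).union (hfr.image j), fun p hp => ?_⟩
  by_cases hpO : p.1 ∈ ⋃₀ 𝒱
  · obtain ⟨W, hW, hpW⟩ := hpO
    refine mem_biUnion (Or.inl ⟨⟨W, hW⟩, rfl⟩) ?_
    rw [← hVU, mem_preimage, hg ⟨W, hW⟩]
    exact hpW
  · have hpV : p.1 ∈ V (j ⟨p, hp⟩) := by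
      have := hj ⟨p, hp⟩
      rwa [← hVU] at this
    refine mem_biUnion (Or.inr ⟨⟨p, hp⟩, ?_, rfl⟩) (hj ⟨p, hp⟩)
    exact ⟨hcl ⟨_, mem_range_self _, hpV⟩, fun h => hpO (interior_subset h)⟩

theorem isLuzinSpace_of_countable_inter [T1Space X] (hd : Dense L) (hX : NoIsolatedPoints X)
    (hLu : ¬ L.Countable) (hL : ∀ N : Set X, IsNowhereDense N → (L ∩ N).Countable) :
    IsLuzinSpace L := by
  refine ⟨not_countable_iff.1 hLu, hd.noIsolatedPoints hX, fun s _ hs => ?_⟩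
  · have := (hL _ hs.image_val).preimage (f := (Subtype.val : L → X)) Subtype.val_injective
    exact this.mono fun x hx => mem_preimage.2 (mem_inter x.2 (mem_image_of_mem _ hx))

end DenseSubspace

/-- One dense open set from the first cover omits only countably many points; each later cover takes
care of one of them. -/
theorem IsLuzinSpace.selOne {X : Type*} [TopologicalSpace X] (hX : IsLuzinSpace X) :
    SelOne (DenseOpenCovers X) (OpenCovers X) := by
  intro 𝒰 h𝒰
  have hcov : ∀ n x, ∃ U ∈ 𝒰 n, x ∈ U := fun n x => by
    have : x ∈ ⋃₀ 𝒰 n := (h𝒰 n).2 ▸ mem_univ x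
    exact this
  have := hX.1
  obtain ⟨x₀⟩ : Nonempty X := inferInstance
  obtain ⟨U₀, hU₀, -⟩ := hcov 0 x₀
  obtain ⟨hU₀o, hU₀d⟩ := (h𝒰 0).1 U₀ hU₀
  have hc : U₀ᶜ.Countable := hX.2.2 _ hU₀o.isClosed_compl (by
    rw [hU₀o.isClosed_compl.isNowhereDense_iff, interior_eq_empty_iff_dense_compl, compl_compl]
    exact hU₀d)
  obtain ⟨y, hy⟩ := (countable_iff_exists_subset_range).1 hc
  choose V hV hyV using fun n => hcov (n + 1) (y n)
  refine ⟨fun n => Nat.casesOn n U₀ V, ?_, ?_, ?_⟩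
  · rintro (_ | n)
    exacts [hU₀, hV n]
  · rintro _ ⟨_ | n, rfl⟩
    exacts [hU₀o, ((h𝒰 _).1 _ (hV n)).1]
  · refine eq_univ_of_forall fun x => ?_
    by_cases hx : x ∈ U₀
    · exact ⟨U₀, ⟨0, rfl⟩, hx⟩
    · obtain ⟨n, rfl⟩ := hy hx
      exact ⟨V n, ⟨n + 1, rfl⟩, hyV n⟩

/-! ### Failure of the weak Menger-type principle -/

namespace PixleyRoy

/-- If continuous integer functions on `X` take simultaneously arbitrarily large values, then dense
subspaces of the Pixley-Roy space of `X` fail the weak Menger-type selection principle. -/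
theorem not_selUfin {X : Type*} [TopologicalSpace X]
    (hX : ∀ K : Set X, IsCompact K → IsNowhereDense K) (φ : ℕ → X → ℤ)
    (hφ : ∀ n, Continuous (φ n)) (hφg : ∀ g : ℕ → ℤ, ∃ x, ∀ n, g n ≤ φ n x)
    {L : Set (PixleyRoy X)} (hL : Dense L) : ¬ SelUfin (OpenCovers L) (WeakCovers L) := by
  intro h
  let V : ℕ → ℤ → Set L := fun n m => {K | K.1.carrier ⊆ {x | φ n x < m}}
  have hVo : ∀ n m, IsOpen (V n m) := by
    intro n m
    have : V n m = Subtype.val ⁻¹' between ∅ {x | φ n x < m} := by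
      ext K
      exact ⟨fun hK => ⟨empty_subset _, hK⟩, fun hK => hK.2⟩
    rw [this]
    exact (isOpen_between _ (isOpen_lt (hφ n) continuous_const)).preimage continuous_subtype_val
  have hVmono : ∀ n m m', m ≤ m' → V n m ⊆ V n m' := fun n m m' hm K hK x hx =>
    (show φ n x < m from hK hx).trans_le hm
  obtain ⟨ℱ, hℱ, hd⟩ := h (fun n => range (V n)) (by
    refine fun n => ⟨?_, eq_univ_of_forall fun K => ?_⟩
    · rintro _ ⟨m, rfl⟩
      exact hVo n m
    · obtain ⟨m, hm⟩ := (K.1.isCompact.image (hφ n)).bddAbove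
      exact ⟨V n (m + 1), ⟨m + 1, rfl⟩, fun x hx =>
        Int.lt_add_one_of_le (hm (mem_image_of_mem _ hx))⟩)
  -- The covers increase with `m`, so a finite selection amounts to a single bound.
  have hg : ∀ n, ∃ m, ⋃₀ ℱ n ⊆ V n m := by
    intro n
    obtain ⟨hfin, hsub⟩ := hℱ n
    choose! i hi using hsub
    obtain ⟨m, hm⟩ := (hfin.image i).bddAbove
    refine ⟨m, sUnion_subset fun W hW => ?_⟩
    rw [← hi hW]
    exact hVmono n _ _ (hm (mem_image_of_mem _ hW))
  choose g hg using hg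
  -- No compact set containing `x` lies in any `V n (g n)`, so the open set `between {x} univ`,
  -- which meets `L`, is missed by the selection.
  obtain ⟨x, hx⟩ := hφg g
  have ho : IsOpen (between {x} univ : Set (PixleyRoy X)) := isOpen_between _ isOpen_univ
  obtain ⟨K, hK, hKL⟩ := hL.inter_open_nonempty _ ho
    ⟨ofCompact hX {x} (singleton_nonempty x) isCompact_singleton, Subset.rfl, subset_univ _⟩
  obtain ⟨H, hH, W, ⟨n, rfl⟩, hHW⟩ := hd.inter_open_nonempty _
    (ho.preimage continuous_subtype_val) ⟨⟨K, hKL⟩, hK⟩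
  have hlt : φ n x < g n := hg n hHW (hH.1 rfl)
  exact absurd (hx n) (not_le.2 hlt)

end PixleyRoy

/-! ### Irrational numbers and continued fractions -/

namespace Irrationals

/-- The image in `ℝ` is closed; an interior point would force a rational into it. -/
theorem isNowhereDense_of_isCompact {K : Set Irrationals} (hK : IsCompact K) :
    IsNowhereDense K := by
  rw [hK.isClosed.isNowhereDense_iff, ← not_nonempty_iff_eq_empty]
  rintro ⟨x, hx⟩
  obtain ⟨U, hU, hUK⟩ := isOpen_induced_iff.1 (isOpen_interior (s := K))
  have hxU : x ∈ Subtype.val ⁻¹' U := hUK ▸ hx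
  obtain ⟨q, hqU, q, rfl⟩ := Rat.denseRange_cast (𝕜 := ℝ) |>.inter_open_nonempty U hU ⟨x, hxU⟩
  have hcl : (q : ℝ) ∈ closure (Subtype.val '' K) := by
    refine closure_mono ?_ (dense_irrational.open_subset_closure_inter hU hqU)
    rintro y ⟨hyU, hy⟩
    have : (⟨y, hy⟩ : Irrationals) ∈ interior K := hUK ▸ hyU
    exact ⟨_, interior_subset this, rfl⟩
  rw [(hK.image continuous_subtype_val).isClosed.closure_eq] at hcl
  obtain ⟨y, -, hy⟩ := hcl
  exact y.2 ⟨q, hy.symm⟩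

/-- Recording all the inverses `(x - q)⁻¹` embeds the irrationals in `ℝ × (ℚ → ℝ)` as the closed set
cut out by the equations `(x - q) * y q = 1`. -/
instance : IsCompletelyMetrizableSpace Irrationals := by
  have hne : ∀ (x : Irrationals) (q : ℚ), x.1 - q ≠ 0 := fun x q h =>
    x.2 ⟨q, (sub_eq_zero.1 h).symm⟩
  let f : Irrationals → ℝ × (ℚ → ℝ) := fun x => (x.1, fun q => (x.1 - q)⁻¹)
  have hf : Continuous f := continuous_subtype_val.prodMk (continuous_pi fun q =>
    (continuous_subtype_val.sub continuous_const).inv₀ fun x => hne x q)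
  refine IsClosedEmbedding.IsCompletelyMetrizableSpace (f := f)
    ⟨.of_comp hf continuous_fst .subtypeVal, ?_⟩
  have : range f = ⋂ q : ℚ, {p : ℝ × (ℚ → ℝ) | (p.1 - q) * p.2 q = 1} := by
    ext ⟨x, y⟩
    simp only [mem_range, mem_iInter, mem_ofPred_eq]
    constructor
    · rintro ⟨z, hz⟩ q
      obtain ⟨rfl, rfl⟩ := Prod.mk.inj hz
      exact mul_inv_cancel₀ (hne z q)
    · intro h
      have hx : Irrational x := by
        rintro ⟨q, rfl⟩
        simpa using h q
      refine ⟨⟨x, hx⟩, Prod.ext rfl (funext fun q => ?_)⟩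
      exact inv_eq_of_mul_eq_one_right (h q)
  rw [this]
  exact isClosed_iInter fun q => isClosed_eq
    ((continuous_fst.sub continuous_const).mul ((continuous_apply q).comp continuous_snd))
    continuous_const

theorem continuous_floor : Continuous fun x : Irrationals => ⌊x.1⌋ := by
  rw [continuous_discrete_rng]
  intro m
  have : (fun x : Irrationals => ⌊x.1⌋) ⁻¹' {m} = Subtype.val ⁻¹' Ioo (m : ℝ) (m + 1) := by
    ext x
    simp only [mem_preimage, mem_singleton_iff, Int.floor_eq_iff, mem_Ioo]
    exact ⟨fun h => ⟨h.1.lt_of_ne fun h' => x.2 ⟨m, by simpa using h'⟩, h.2⟩,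
      fun h => ⟨h.1.le, h.2⟩⟩
  rw [this]
  exact isOpen_Ioo.preimage continuous_subtype_val

/-- The Gauss map on all irrationals: the inverse of the fractional part. -/
noncomputable def gaussMap (x : Irrationals) : Irrationals :=
  ⟨(x.1 - ⌊x.1⌋)⁻¹, (x.2.sub_intCast _).inv⟩

theorem continuous_gaussMap : Continuous gaussMap := by
  refine Continuous.subtype_mk (Continuous.inv₀ (continuous_subtype_val.sub
    (continuous_of_discreteTopology.comp continuous_floor)) fun x hx => ?_) _
  exact x.2.sub_intCast ⌊x.1⌋ ⟨0, by simpa using hx.symm⟩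

/-- Nested sets whose intersection holds the continued fraction with partial quotients `a`. -/
def cylinder : ℕ → (ℕ → ℤ) → Set ℝ
  | 0, a => Icc (a 0) (a 0 + 1)
  | n + 1, a => (fun y => a 0 + y⁻¹) '' cylinder n (fun k => a (k + 1))

variable {a : ℕ → ℤ}

theorem cylinder_subset_Icc (n : ℕ) (ha : ∀ k, 1 ≤ a k) :
    cylinder n a ⊆ Icc (a 0) (a 0 + 1) := by
  induction n generalizing a with
  | zero => exact Subset.rfl
  | succ n ih =>
    rintro _ ⟨y, hy, rfl⟩
    have h1 : (1 : ℝ) ≤ y := le_trans (by exact_mod_cast ha 1) (ih (fun k => ha (k + 1)) hy).1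
    have h2 := inv_le_one_of_one_le₀ h1
    have h3 : 0 ≤ y⁻¹ := by positivity
    exact ⟨by simpa using h3, by simpa using h2⟩

theorem one_le_of_mem_cylinder {n : ℕ} (ha : ∀ k, 1 ≤ a k) {y : ℝ} (hy : y ∈ cylinder n a) :
    1 ≤ y :=
  le_trans (by exact_mod_cast ha 0) (cylinder_subset_Icc n ha hy).1

theorem isCompact_cylinder (n : ℕ) (ha : ∀ k, 1 ≤ a k) : IsCompact (cylinder n a) := by
  induction n generalizing a with
  | zero => exact isCompact_Icc
  | succ n ih =>
    refine (ih fun k => ha (k + 1)).image_of_continuousOn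
      (continuousOn_const.add (continuousOn_id.inv₀ fun y hy => ?_))
    exact (zero_lt_one.trans_le (one_le_of_mem_cylinder (fun k => ha (k + 1)) hy)).ne'

theorem cylinder_nonempty (n : ℕ) (a : ℕ → ℤ) : (cylinder n a).Nonempty := by
  induction n generalizing a with
  | zero => exact nonempty_Icc.2 (by simp)
  | succ n ih => exact (ih _).image _

theorem cylinder_succ_subset (n : ℕ) (ha : ∀ k, 1 ≤ a k) :
    cylinder (n + 1) a ⊆ cylinder n a := by
  induction n generalizing a with
  | zero => exact cylinder_subset_Icc 1 ha
  | succ n ih => exact image_mono (ih fun k => ha (k + 1))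

theorem iInter_cylinder_nonempty (ha : ∀ k, 1 ≤ a k) : (⋂ n, cylinder n a).Nonempty :=
  IsCompact.nonempty_iInter_of_sequence_nonempty_isCompact_isClosed _
    (fun n => cylinder_succ_subset n ha) (fun n => cylinder_nonempty n a)
    (isCompact_cylinder 0 ha) fun n => (isCompact_cylinder n ha).isClosed

theorem exists_mem_iInter_cylinder_shift {x : ℝ} (hx : x ∈ ⋂ n, cylinder n a) :
    ∃ y ∈ ⋂ n, cylinder n (fun k => a (k + 1)), x = a 0 + y⁻¹ := by
  have hx := mem_iInter.1 hx
  refine ⟨(x - a 0)⁻¹, mem_iInter.2 fun n => ?_, by simp⟩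
  obtain ⟨y, hy, rfl⟩ := hx (n + 1)
  simpa using hy

theorem one_lt_of_mem_iInter_cylinder (ha : ∀ k, 1 ≤ a k) {x : ℝ}
    (hx : x ∈ ⋂ n, cylinder n a) : 1 < x := by
  obtain ⟨y, hy, rfl⟩ := exists_mem_iInter_cylinder_shift hx
  have h1 := one_le_of_mem_cylinder (fun k => ha (k + 1)) (mem_iInter.1 hy 0)
  have h2 : (1 : ℝ) ≤ a 0 := by exact_mod_cast ha 0
  have h3 : 0 < y⁻¹ := by positivity
  linarith

/-- Infinite descent on the denominator: if `p / q = a 0 + y⁻¹` with `y > 1`, then `y = q / (p - a 0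
* q)`, where `0 < p - a 0 * q < q`, and `y` belongs to the shifted sequence. -/
theorem irrational_of_mem_iInter_cylinder (ha : ∀ k, 1 ≤ a k) {x : ℝ}
    (hx : x ∈ ⋂ n, cylinder n a) : Irrational x := by
  have key : ∀ q : ℕ, ∀ p : ℤ, ∀ a : ℕ → ℤ, 0 < q → (∀ k, 1 ≤ a k) →
      (p / q : ℝ) ∉ ⋂ n, cylinder n a := by
    intro q
    induction q using Nat.strong_induction_on with
    | _ q ih =>
      intro p a hq ha hmem
      obtain ⟨y, hy, hpq⟩ := exists_mem_iInter_cylinder_shift hmem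
      have hy1 := one_lt_of_mem_iInter_cylinder (fun k => ha (k + 1)) hy
      have hq0 : (0 : ℝ) < q := by exact_mod_cast hq
      have hr : ((p - a 0 * q : ℤ) : ℝ) = q * y⁻¹ := by
        rw [div_eq_iff hq0.ne'] at hpq
        push_cast
        rw [hpq]
        ring
      have hpos : 0 < p - a 0 * q := by
        have : (0 : ℝ) < ((p - a 0 * q : ℤ) : ℝ) := hr ▸ by positivity
        exact_mod_cast this
      have hlt : p - a 0 * q < q := by
        have : ((p - a 0 * q : ℤ) : ℝ) < (q : ℝ) := by
          rw [hr]
          exact mul_lt_of_lt_one_right hq0 (inv_lt_one_of_one_lt₀ hy1)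
        exact_mod_cast this
      obtain ⟨q', hq'⟩ := Int.eq_ofNat_of_zero_le hpos.le
      rw [hq'] at hr hpos hlt
      have hyq : y = ((q : ℤ) : ℝ) / (q' : ℝ) := by
        have : (q' : ℝ) = q * y⁻¹ := by exact_mod_cast hr
        rw [this]
        push_cast
        field_simp
      exact ih q' (by exact_mod_cast hlt) q _ (by exact_mod_cast hpos) (fun k => ha (k + 1))
        (hyq ▸ hy)
  rintro ⟨q, rfl⟩
  refine key q.den q.num a q.pos ha ?_
  rwa [← Rat.cast_def]

/-- A point of all cylinders is `a 0 + y⁻¹` with `y > 1`, so its floor is `a 0` and the Gauss map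
sends it to `y`, a point for the shifted sequence. -/
theorem exists_floor_iterate_gaussMap_eq (ha : ∀ k, 1 ≤ a k) :
    ∃ x : Irrationals, ∀ n, ⌊(gaussMap^[n] x).1⌋ = a n := by
  have key : ∀ n (a : ℕ → ℤ) (x : Irrationals), (∀ k, 1 ≤ a k) → x.1 ∈ ⋂ n, cylinder n a →
      ⌊(gaussMap^[n] x).1⌋ = a n := by
    intro n
    induction n with
    | zero =>
      intro a x ha hx
      obtain ⟨y, hy, hxy⟩ := exists_mem_iInter_cylinder_shift hx
      have hy1 := one_lt_of_mem_iInter_cylinder (fun k => ha (k + 1)) hy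
      have h1 := inv_lt_one_of_one_lt₀ hy1
      have h2 : 0 < y⁻¹ := by positivity
      exact Int.floor_eq_iff.2 ⟨by simp only [Function.iterate_zero, id]; linarith,
        by simp only [Function.iterate_zero, id]; linarith⟩
    | succ n ih =>
      intro a x ha hx
      obtain ⟨y, hy, hxy⟩ := exists_mem_iInter_cylinder_shift hx
      have hy1 := one_lt_of_mem_iInter_cylinder (fun k => ha (k + 1)) hy
      have h1 := inv_lt_one_of_one_lt₀ hy1
      have h2 : 0 < y⁻¹ := by positivity
      have hfl : ⌊x.1⌋ = a 0 := Int.floor_eq_iff.2 ⟨by linarith, by linarith⟩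
      rw [Function.iterate_succ_apply]
      refine ih (fun k => a (k + 1)) (gaussMap x) (fun k => ha (k + 1)) ?_
      have : (gaussMap x).1 = y := by
        change (x.1 - ⌊x.1⌋)⁻¹ = y
        rw [hfl, hxy, add_sub_cancel_left, inv_inv]
      rwa [this]
  obtain ⟨x, hx⟩ := iInter_cylinder_nonempty ha
  exact ⟨⟨x, irrational_of_mem_iInter_cylinder ha hx⟩, fun n => key n a _ ha hx⟩

end Irrationals

/-! ### The main theorem -/

theorem theorem3p4 (hCH : Cardinal.continuum.{0} = Cardinal.aleph.{0} 1) :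
    ∃ L : Set (PixleyRoy Irrationals),
      Dense L ∧ IsLuzinSpace L ∧
      T1Space L ∧ HereditarilyLindelofSpace L ∧ FirstCountableTopology L ∧
      ZeroDimensional L ∧ NoIsolatedPoints L ∧ HasGdeltaDiagonal L ∧
      SelOne (DenseOpenCovers L) (OpenCovers L) ∧
      ¬ SelUfin (OpenCovers L) (WeakCovers L) := by
  have hK : ∀ K : Set Irrationals, IsCompact K → IsNowhereDense K := fun _ =>
    Irrationals.isNowhereDense_of_isCompact
  have hNI : NoIsolatedPoints (PixleyRoy Irrationals) := PixleyRoy.noIsolatedPoints hK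
  have hccc : ∀ 𝒲 : Set (Set (PixleyRoy Irrationals)), (∀ U ∈ 𝒲, IsOpen U) →
      ∃ 𝒱 ⊆ 𝒲, 𝒱.Countable ∧ ⋃₀ 𝒲 ⊆ closure (⋃₀ 𝒱) :=
    exists_countable_dense_subfamily (PixleyRoy.countable_of_pairwiseDisjoint hK)
  have hBaire : BaireSpace (PixleyRoy Irrationals) := PixleyRoy.baireSpace hK
  obtain ⟨ι, B, hι, hB, hbase⟩ := PixleyRoy.exists_base_card_le_continuum Irrationals
  let x₀ : PixleyRoy Irrationals := PixleyRoy.ofCompact hK {⟨√2, irrational_sqrt_two⟩}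
    (singleton_nonempty _) isCompact_singleton
  have : Nonempty ι := (hbase univ isOpen_univ x₀ (mem_univ _)).nonempty
  obtain ⟨x, hx, hxN⟩ := exists_denseRange_countable_preimage hCH B hι hB hbase hccc
  have hsing : ∀ y : PixleyRoy Irrationals, IsNowhereDense {y} := fun y => by
    rw [isClosed_singleton.isNowhereDense_iff]
    refine eq_empty_of_forall_notMem fun z hz => hNI y ?_
    have hzy : z = y := mem_singleton_iff.1 (interior_subset hz)
    rw [hzy] at hz
    have : interior {y} = {y} := interior_subset.antisymm (singleton_subset_iff.2 hz)
    exact this ▸ isOpen_interior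
  -- The map `x` need not be injective, but its fibres are countable because singletons are nowhere
  -- dense.
  have hLu : ¬ (range x).Countable := fun h => by
    have hc : (⋃ y ∈ range x, x ⁻¹' {y}).Countable := h.biUnion fun y _ => hxN _ (hsing y)
    rw [biUnion_preimage_singleton, preimage_range] at hc
    exact Cardinal.not_countable_real hc
  have hLN : ∀ N : Set (PixleyRoy Irrationals), IsNowhereDense N → (range x ∩ N).Countable :=
    fun N hN => by
      rw [inter_comm, ← image_preimage_eq_inter_range]
      exact (hxN N hN).image x
  have hluz := isLuzinSpace_of_countable_inter hx hNI hLu hLN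
  exact ⟨range x, hx, hluz, inferInstance, hereditarilyLindelofSpace_of_countable_inter hccc hLN,
    inferInstance, PixleyRoy.zeroDimensional.subtype _, hluz.2.1,
    PixleyRoy.hasGdeltaDiagonal.subtype _, hluz.selOne,
    PixleyRoy.not_selUfin hK (fun n y => ⌊(Irrationals.gaussMap^[n] y).1⌋)
      (fun n => Irrationals.continuous_floor.comp (Irrationals.continuous_gaussMap.iterate n))
      (fun g => by
        obtain ⟨y, hy⟩ := Irrationals.exists_floor_iterate_gaussMap_eq
          -- Partial quotients must be at least `1`, hence the maximum.
          (a := fun n => max 1 (g n)) fun n => le_max_left _ _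
        exact ⟨y, fun n => (hy n).symm ▸ le_max_right _ _⟩) hx⟩
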